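/- Let $P,Q$ be nonzero integers with $D=P^2-4Q\neq 0$, let $U=(U_n)_{n\ge0}$ and $V=(V_n)_{n\ge0}$ be the Lucas sequences $U_0=0$, $U_1=1$, $V_0=2$, $V_1=P$, both satisfying $X_{n+2}=PX_{n+1}-QX_n$, and assume they are nondegenerate: $U_n,V_n\neq0$ for all $n\ge1$. Write $U=U(P,Q)$. No coprimality of $P$ and $Q$ is assumed. For a sequence $A$ of integers that are nonzero for $n\ge1$, let $M^A_n=\prod_{d\mid n}A_d^{\mu(n/d)}$ ($n\ge1$) be its Möbius dual. Let $p$ be a prime, $v_p$ the $p$-adic valuation, $\partial_p(m)=m/p^{v_p(m)}$ for $m\ne0$, $\varphi$ Euler's function, and $z_U(p)=\min\{n\ge1: p\mid U_n\}$ if this minimum exists. If $p\nmid (P,Q)$: (a) If $p\mid Q$, then $v_p(M^U_n)=0$ for all $n\ge1$. (b) If $p\mid D$, then $v_p(M^U_n)=v_p(U_p)$ if $n=p$; $v_p(M^U_n)=1$ if $n=p^k$ with $k>1$; and $v_p(M^U_n)=0$ for all other $n\ge1$. (c) If $p\nmid QD$, then $z=z_U(p)$ exists, and $v_p(M^U_n)=v_p(U_{z})$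 if $n=z$; $v_p(M^U_n)=v_p(U_{pz})-v_p(U_{z})$ if $n=pz$; $v_p(M^U_n)=1$ if $n=p^kz$ with $k>1$; and $v_p(M^U_n)=0$ for all other $n\ge1$. If $p\mid(P,Q)$: (d) If $v_p(Q)\ge 2v_p(P)$, put $U^{(p)}=U\bigl(P/p^{v_p(P)},\,Q/p^{2v_p(P)}\bigr)$ (which is $U(\partial_p(P),\partial_p(Q))$ when $v_p(Q)=2v_p(P)$). Then $U^{(p)}$ is nondegenerate, $v_p(M^U_1)=0$, and $v_p(M^U_n)=\varphi(n)v_p(P)+v_p(M^{U^{(p)}}_n)$ for all $n>1$. (e) If $2v_p(P)>v_p(Q)$, then $$v_p(M^U_n)=\begin{cases} v_p(P), & n=2,\\ (\varphi(n)/2)\,v_p(Q)+1, & n=2p^k,\ k\ge1,\\ \lfloor\varphi(n)/2\rfloor\, v_p(Q), & \text{for all other } n\ge1,\end{cases}$$ unless $2v_p(P)=v_p(Q)+1$, $p\in\{2,3\}$ and $n=2p$, in which case $\partial_p(P)^2-\partial_p(Q)\ne0$ and $$v_p(M^U_{2p})=v_p(Q)+1+v_p\bigl(\partial_p(P)^2-\partial_p(Q)\bigr).$$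 -/

import Mathlib

/-- The Lucas sequence of the first kind `U(P, Q)`. -/
def lucasU (P Q : ℤ) : ℕ → ℤ
  | 0 => 0
  | 1 => 1
  | n + 2 => P * lucasU P Q (n + 1) - Q * lucasU P Q n

/-- The Lucas sequence of the second kind `V(P, Q)`. -/
def lucasV (P Q : ℤ) : ℕ → ℤ
  | 0 => 2
  | 1 => P
  | n + 2 => P * lucasV P Q (n + 1) - Q * lucasV P Q n

/-- The Binet form of `U(P, Q)`, for the roots `α`, `β` of `X ^ 2 - P * X + Q` in any field. -/
theorem lucasU_binet {K : Type*} [Field K] (P Q : ℤ) (α β : K) (hs : α + β = P) (hp : α * β = Q)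
    (hne : α ≠ β) (n : ℕ) : (lucasU P Q n : K) = (α ^ n - β ^ n) / (α - β) := by
  have hd : α - β ≠ 0 := sub_ne_zero.mpr hne
  rw [eq_div_iff hd]
  induction n using Nat.twoStepInduction with
  | zero => simp [lucasU]
  | one => simp [lucasU]
  | more n h0 h1 =>
    simp only [lucasU]
    push_cast
    rw [← hs, ← hp]
    linear_combination (α + β) * h1 - α * β * h0

/-- The Binet form of `V(P, Q)`. -/
theorem lucasV_binet {K : Type*} [Field K] (P Q : ℤ) (α β : K) (hs : α + β = P) (hp : α * β = Q)
    (n : ℕ) : (lucasV P Q n : K) = α ^ n + β ^ n := by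
  induction n using Nat.twoStepInduction with
  | zero => norm_num [lucasV]
  | one => simp [lucasV, hs]
  | more n h0 h1 =>
    simp only [lucasV]
    push_cast
    rw [← hs, ← hp]
    linear_combination (α + β) * h1 - α * β * h0

/-- The discriminant `D = P ^ 2 - 4 * Q` of the characteristic polynomial `X ^ 2 - P * X + Q`. -/
def lucasD (P Q : ℤ) : ℤ := P ^ 2 - 4 * Q

/-- `(P, Q)` are the parameters of a pair of nondegenerate Lucas sequences: both parameters and the
discriminant are nonzero, and `U_n, V_n ≠ 0` for all `n ≥ 1`. -/
structure LucasNondegenerate (P Q : ℤ) : Prop where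
  P_ne_zero : P ≠ 0
  Q_ne_zero : Q ≠ 0
  D_ne_zero : lucasD P Q ≠ 0
  U_ne_zero : ∀ n : ℕ, 1 ≤ n → lucasU P Q n ≠ 0
  V_ne_zero : ∀ n : ℕ, 1 ≤ n → lucasV P Q n ≠ 0

/-- The Möbius dual `M^A_n = ∏_{d ∣ n} A_d ^ μ(n / d)` of a sequence `A` of integers that are
nonzero for `n ≥ 1`. -/
def moebiusDual (A : ℕ → ℤ) (n : ℕ) : ℚ :=
  ∏ d ∈ n.divisors, (A d : ℚ) ^ (ArithmeticFunction.moebius (n / d))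

/-- The entry point (rank of apparition) `z_A(p)`: the least `n ≥ 1` with `p ∣ A_n`. -/
noncomputable def entryPoint (A : ℕ → ℤ) (p : ℕ) : ℕ :=
  sInf {n : ℕ | 1 ≤ n ∧ (p : ℤ) ∣ A n}

/-- The `p`-free part `∂_p(m) = m / p ^ v_p(m)` of a nonzero integer `m`; the division is exact. -/
def pFreePart (p : ℕ) (m : ℤ) : ℤ := m / (p : ℤ) ^ padicValInt p m

/-- The sequence `U^{(p)} = U(P / p ^ v_p(P), Q / p ^ (2 * v_p(P)))`, used when
`2 * v_p(P) ≤ v_p(Q)`, so that both divisions are exact. -/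
def lucasUReduced (p : ℕ) (P Q : ℤ) : ℕ → ℤ :=
  lucasU (pFreePart p P) (Q / (p : ℤ) ^ (2 * padicValInt p P))

/-! By Möbius inversion, n ↦ v_p(M^U_n) is the unique function on n ≥ 1 whose sum over the divisors
of n is v_p(U_n). Each case therefore reduces to computing v_p(U_n) and summing the claimed values
(`padicValRat_moebiusDual_eq`).

Let p ∤ Q, with rank z and roots α, β. Expanding α^(tm) = (U_m α + c)^t, c = U_{m+1} - P U_m, gives
U_{tm} = U_m (t c^(t-1) + terms divisible by U_m), and p ∤ c when p ∣ U_m. So multiplying such an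
index m by t prime to p preserves the valuation, and multiplying it by p adds one, except perhaps at
the step z → 2z for p = 2. The dual then has nonzero valuation only at the indices p^k z
(`padicValRat_moebiusDual_lucasU`); p ∣ D is the case z = p. If p ∣ Q and p ∤ P, then p divides no
U_n with n ≥ 1.

Let p divide both parameters. Scaling the roots by p^r multiplies U_n by p^(r(n-1)), and ∑ φ(d) = n
yields the term φ(n) r. If 2 v_p(P) > v_p(Q) = s, write Q = p^s Q' and P² = p^(s+1) R. The squared
roots divided by p^s have parameters (pR - 2Q', Q'²), whose discriminant is divisible by p while p ∤
Q'². Even indices are thereby reduced to the case p ∣ D, and odd ones have valuation s(n-1)/2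
(`padicValRat_moebiusDual_lucasU_of_lt`). The exceptions in (e) arise because v_p(U_p) = 1 is
automatic for p ∣ D only when p ≥ 5. -/

/-! ### Möbius inversion for valuations -/

theorem padicValRat_prod {ι : Type*} (p : ℕ) [Fact p.Prime] (s : Finset ι) (f : ι → ℚ)
    (hf : ∀ i ∈ s, f i ≠ 0) : padicValRat p (∏ i ∈ s, f i) = ∑ i ∈ s, padicValRat p (f i) := by
  classical
  induction s using Finset.induction_on with
  | empty => simp
  | insert a s ha ih =>
    rw [Finset.prod_insert ha, Finset.sum_insert ha, padicValRat.mul (hf a (by simp))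
      (Finset.prod_ne_zero_iff.mpr fun i hi => hf i (by simp [hi])),
      ih fun i hi => hf i (by simp [hi])]

/-- The divisor sums of the valuations of the Möbius dual are the valuations of the sequence. -/
theorem sum_divisors_padicValRat_moebiusDual {p : ℕ} [Fact p.Prime] {A : ℕ → ℤ}
    (hA : ∀ n, 1 ≤ n → A n ≠ 0) {n : ℕ} (hn : 1 ≤ n) :
    ∑ d ∈ n.divisors, padicValRat p (moebiusDual A d) = padicValInt p (A n) := by
  refine ArithmeticFunction.sum_eq_iff_sum_smul_moebius_eq
    (f := fun n => padicValRat p (moebiusDual A n))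
    (g := fun n => (padicValInt p (A n) : ℤ)) |>.mpr (fun n _ => ?_) n hn
  have hd : ∀ d ∈ n.divisors, (A d : ℚ) ≠ 0 := fun d hd => by
    exact_mod_cast hA d (Nat.pos_of_mem_divisors hd)
  rw [moebiusDual, padicValRat_prod p _ _ fun d hd' => zpow_ne_zero _ (hd d hd'),
    Nat.sum_divisorsAntidiagonal'
      (fun a b => ArithmeticFunction.moebius a • (padicValInt p (A b) : ℤ))]
  refine Finset.sum_congr rfl fun d _ => ?_
  rw [padicValRat.zpow, padicValRat.of_int, smul_eq_mul]

/-- Möbius inversion for the `p`-adic valuations of the Möbius dual. -/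
theorem padicValRat_moebiusDual_eq {p : ℕ} [Fact p.Prime] {A : ℕ → ℤ} (hA : ∀ n, 1 ≤ n → A n ≠ 0)
    {g : ℕ → ℤ} (hg : ∀ n, 1 ≤ n → ∑ d ∈ n.divisors, g d = padicValInt p (A n)) {n : ℕ}
    (hn : 1 ≤ n) : padicValRat p (moebiusDual A n) = g n := by
  have h (f : ℕ → ℤ) := (ArithmeticFunction.sum_eq_iff_sum_smul_moebius_eq (f := f)
    (g := fun n => (padicValInt p (A n) : ℤ))).mp
  rw [← h g hg n hn, ← h (fun n => padicValRat p (moebiusDual A n))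
    (fun m hm => sum_divisors_padicValRat_moebiusDual hA hm) n hn]

theorem padicValInt_mul_of_not_dvd {p : ℕ} [Fact p.Prime] {a b : ℤ} (ha : a ≠ 0)
    (hb : ¬ (p : ℤ) ∣ b) : padicValInt p (a * b) = padicValInt p a := by
  have hb0 : b ≠ 0 := by rintro rfl; simp at hb
  rw [padicValInt.mul ha hb0, padicValInt.eq_zero_of_not_dvd hb, add_zero]

theorem padicValInt_pow_mul {p : ℕ} [hp : Fact p.Prime] {b : ℤ} (hb : b ≠ 0) (k : ℕ) :
    padicValInt p ((p : ℤ) ^ k * b) = k + padicValInt p b := by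
  have hp0 : (p : ℤ) ≠ 0 := by exact_mod_cast hp.out.ne_zero
  rw [padicValInt.mul (pow_ne_zero _ hp0) hb]
  congr 1
  induction k with
  | zero => simp
  | succ k ih => rw [pow_succ, padicValInt.mul (pow_ne_zero _ hp0) hp0, ih,
      padicValInt.self hp.out.one_lt]

theorem pow_padicValInt_mul_pFreePart (p : ℕ) [Fact p.Prime] (m : ℤ) :
    (p : ℤ) ^ padicValInt p m * pFreePart p m = m :=
  Int.mul_ediv_cancel' (padicValInt_dvd m)

theorem not_dvd_pFreePart {p : ℕ} [hp : Fact p.Prime] {m : ℤ} (hm : m ≠ 0) :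
    ¬ (p : ℤ) ∣ pFreePart p m := by
  rintro ⟨c, hc⟩
  have h : (p : ℤ) ^ (padicValInt p m + 1) ∣ m :=
    ⟨c, by rw [pow_succ, mul_assoc, ← hc, pow_padicValInt_mul_pFreePart]⟩
  rcases (padicValInt_dvd_iff _ _).mp h with h | h
  · exact hm h
  · omega

/-- The function with value `w k` at `p ^ k * z` for all `k`, and `0` elsewhere. -/
def primePowerSupport (p z : ℕ) (w : ℕ → ℤ) (n : ℕ) : ℤ :=
  ∑ k ∈ Finset.range n, if n = p ^ k * z then w k else 0

theorem primePowerSupport_self {p z : ℕ} (hp : p.Prime) (hz : 1 ≤ z) (w : ℕ → ℤ) (k : ℕ) :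
    primePowerSupport p z w (p ^ k * z) = w k := by
  rw [primePowerSupport, Finset.sum_eq_single k]
  · simp
  · intro j _ hj
    rw [if_neg]
    intro h
    exact hj (Nat.pow_right_injective hp.two_le (Nat.eq_of_mul_eq_mul_right hz h)).symm
  · intro h
    -- The truncation to `range n` loses nothing, because k < p^k ≤ p^k z.
    refine absurd (Finset.mem_range.mpr ?_) h
    calc k < p ^ k := Nat.lt_pow_self hp.one_lt
      _ ≤ p ^ k * z := Nat.le_mul_of_pos_right _ hz

theorem primePowerSupport_eq_zero {p z n : ℕ} {w : ℕ → ℤ} (h : ∀ k, w k ≠ 0 → n ≠ p ^ k * z) :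
    primePowerSupport p z w n = 0 := by
  refine Finset.sum_eq_zero fun k _ => ?_
  split_ifs with hk
  · by_contra hw
    exact h k hw hk
  · rfl

/-- As p ∤ t, the divisors of p^k t z of the form p^j z are exactly those with j ≤ k. -/
theorem sum_divisors_primePowerSupport {p z t : ℕ} (hp : p.Prime) (hz : 1 ≤ z) (ht : ¬ p ∣ t)
    (w : ℕ → ℤ) (k : ℕ) :
    ∑ d ∈ (p ^ k * t * z).divisors, primePowerSupport p z w d = ∑ j ∈ Finset.range (k + 1), w j := by
  have ht0 : t ≠ 0 := by rintro rfl; simp at ht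
  have hinj : Function.Injective fun j => p ^ j * z := fun i j h =>
    Nat.pow_right_injective hp.two_le (Nat.eq_of_mul_eq_mul_right hz h)
  have h1 : ∑ j ∈ Finset.range (k + 1), w j =
      ∑ d ∈ (Finset.range (k + 1)).image (fun j => p ^ j * z), primePowerSupport p z w d := by
    rw [Finset.sum_image fun i _ j _ h => hinj h]
    exact Finset.sum_congr rfl fun j _ => (primePowerSupport_self hp hz w j).symm
  rw [h1]
  symm
  refine Finset.sum_subset ?_ ?_
  · intro d hd
    obtain ⟨j, hj, rfl⟩ := Finset.mem_image.mp hd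
    rw [Nat.mem_divisors]
    refine ⟨Nat.mul_dvd_mul_right (Dvd.dvd.mul_right (pow_dvd_pow p ?_) t) z, ?_⟩
    · have := Finset.mem_range.mp hj; omega
    · have := hp.ne_zero; positivity
  · intro d hd hd'
    refine primePowerSupport_eq_zero fun j _ hj => hd' (Finset.mem_image.mpr ⟨j, ?_, hj.symm⟩)
    have h2 := Nat.dvd_of_mem_divisors hd
    rw [hj] at h2
    have h3 := Nat.dvd_of_mul_dvd_mul_right hz h2
    have h4 : p ^ j ∣ p ^ k :=
      Nat.Coprime.dvd_of_dvd_mul_right (Nat.Coprime.pow_left j ((hp.coprime_iff_not_dvd).mpr ht)) h3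
    have := (Nat.pow_dvd_pow_iff_le_right hp.one_lt).mp h4
    exact Finset.mem_range.mpr (by omega)

theorem sum_divisors_primePowerSupport_of_not_dvd {p z n : ℕ} (hn : ¬ z ∣ n) (w : ℕ → ℤ) :
    ∑ d ∈ n.divisors, primePowerSupport p z w d = 0 :=
  Finset.sum_eq_zero fun d hd => primePowerSupport_eq_zero fun _ _ hk =>
    hn ((hk ▸ Dvd.intro_left _ rfl : z ∣ d).trans (Nat.dvd_of_mem_divisors hd))

/-! ### Identities for Lucas sequences -/

/-- This is the norm of α^m = U_{m+1} - β U_m. It shows that a prime not dividing Q cannot divide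
two consecutive terms. -/
theorem lucasU_norm (P Q : ℤ) (m : ℕ) :
    lucasU P Q (m + 1) ^ 2 - P * lucasU P Q m * lucasU P Q (m + 1) + Q * lucasU P Q m ^ 2 =
      Q ^ m := by
  induction m with
  | zero => simp [lucasU]
  | succ m ih =>
    rw [pow_succ Q, ← ih]
    simp only [lucasU]
    ring

theorem exists_lucas_roots (P Q : ℤ) (hD : lucasD P Q ≠ 0) :
    ∃ α β : ℂ, α + β = P ∧ α * β = Q ∧ α ≠ β := by
  obtain ⟨δ, hδ⟩ := IsAlgClosed.exists_pow_nat_eq (lucasD P Q : ℂ) two_pos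
  have hδ0 : δ ≠ 0 := by
    rintro rfl
    apply hD
    have : (lucasD P Q : ℂ) = 0 := by rw [← hδ]; simp
    exact_mod_cast this
  refine ⟨(P + δ) / 2, (P - δ) / 2, by ring, ?_, ?_⟩
  · rw [lucasD] at hδ
    push_cast at hδ
    linear_combination (-1 / 4) * hδ
  · intro h
    apply hδ0
    linear_combination h

theorem lucas_root_pow {K : Type*} [Field K] (P Q : ℤ) (α β : K) (hs : α + β = P)
    (hp : α * β = Q) (m : ℕ) :
    α ^ m = lucasU P Q m * α + (lucasU P Q (m + 1) - P * lucasU P Q m : ℤ) := by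
  induction m with
  | zero => simp [lucasU]
  | succ m ih =>
    rw [pow_succ, ih]
    simp only [lucasU]
    push_cast
    rw [← hs, ← hp]
    ring

/-- Binomial expansion, with Binet applied termwise. Taking uα + c = α^m gives the multiplication
formula; u = 1 gives the translation of the roots by c. -/
theorem sum_choose_lucasU {K : Type*} [Field K] (P Q : ℤ) (α β : K) (hs : α + β = P)
    (hp : α * β = Q) (hne : α ≠ β) (u c : K) (t : ℕ) :
    (u * α + c) ^ t - (u * β + c) ^ t =
      (α - β) * ∑ k ∈ Finset.range (t + 1), t.choose k * c ^ (t - k) * u ^ k * lucasU P Q k := by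
  have hd : α - β ≠ 0 := sub_ne_zero.mpr hne
  rw [add_pow, add_pow, ← Finset.sum_sub_distrib, Finset.mul_sum]
  refine Finset.sum_congr rfl fun k _ => ?_
  rw [lucasU_binet P Q α β hs hp hne]
  field_simp
  ring

theorem lucasU_mul_eq_sum {P Q : ℤ} (hD : lucasD P Q ≠ 0) (t m : ℕ) :
    lucasU P Q (t * m) = ∑ k ∈ Finset.range (t + 1), (t.choose k : ℤ) *
      (lucasU P Q (m + 1) - P * lucasU P Q m) ^ (t - k) * lucasU P Q m ^ k * lucasU P Q k := by
  obtain ⟨α, β, hs, hp, hne⟩ := exists_lucas_roots P Q hD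
  have hd : α - β ≠ 0 := sub_ne_zero.mpr hne
  have h := sum_choose_lucasU P Q α β hs hp hne (lucasU P Q m)
    ((lucasU P Q (m + 1) - P * lucasU P Q m : ℤ) : ℂ) t
  rw [← lucas_root_pow P Q α β hs hp, ← lucas_root_pow P Q β α (by rw [add_comm, hs])
    (by rw [mul_comm, hp]), ← pow_mul, ← pow_mul, mul_comm m t] at h
  have h2 := lucasU_binet P Q α β hs hp hne (t * m)
  rw [h, mul_div_cancel_left₀ _ hd] at h2
  exact_mod_cast h2

theorem lucasU_shift {P Q : ℤ} (hD : lucasD P Q ≠ 0) (r : ℤ) (t : ℕ) :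
    lucasU P Q t = ∑ k ∈ Finset.range (t + 1), (t.choose k : ℤ) * r ^ (t - k) *
      lucasU (P - 2 * r) (Q - r * P + r ^ 2) k := by
  obtain ⟨α, β, hs, hp, hne⟩ := exists_lucas_roots P Q hD
  have hd : α - β ≠ 0 := sub_ne_zero.mpr hne
  have h := sum_choose_lucasU (P - 2 * r) (Q - r * P + r ^ 2) (α - r) (β - r)
    (by push_cast; linear_combination hs) (by push_cast; linear_combination hp - r * hs)
    (fun h => hne (by linear_combination h)) 1 r t
  have h2 := lucasU_binet P Q α β hs hp hne t
  simp only [one_mul, one_pow, mul_one, sub_add_cancel, sub_sub_sub_cancel_right] at h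
  rw [h, mul_div_cancel_left₀ _ hd] at h2
  exact_mod_cast h2

theorem lucasU_scale (a P Q : ℤ) (n : ℕ) :
    lucasU (a * P) (a ^ 2 * Q) (n + 1) = a ^ n * lucasU P Q (n + 1) := by
  induction n using Nat.twoStepInduction with
  | zero => simp [lucasU]
  | one => simp [lucasU]
  | more n h0 h1 =>
    rw [lucasU, h1, h0, lucasU.eq_3 P Q (n + 1)]
    ring

theorem lucasV_scale (a P Q : ℤ) (n : ℕ) :
    lucasV (a * P) (a ^ 2 * Q) n = a ^ n * lucasV P Q n := by
  induction n using Nat.twoStepInduction with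
  | zero => simp [lucasV]
  | one => simp [lucasV]
  | more n h0 h1 =>
    rw [lucasV, h1, h0, lucasV]
    ring

/-- P² - 2Q and Q² are the parameters of the squared roots, and α² - β² = P(α - β). -/
theorem lucasU_two_mul {P Q : ℤ} (m : ℕ) :
    lucasU P Q (2 * m) = P * lucasU (P ^ 2 - 2 * Q) (Q ^ 2) m := by
  induction m using Nat.twoStepInduction with
  | zero => simp [lucasU]
  | one => simp [lucasU]
  | more m h0 h1 =>
    rw [lucasU.eq_3 (P ^ 2 - 2 * Q), mul_sub, mul_left_comm P, mul_left_comm P, ← h0, ← h1]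
    have e : 2 * (m + 2) = (2 * m + 2) + 2 := by ring
    have e1 : 2 * (m + 1) = 2 * m + 2 := by ring
    rw [e, e1]
    simp only [lucasU]
    ring

/-! ### The rank of apparition -/

theorem lucasU_dOcagne (P Q : ℤ) (i d : ℕ) :
    lucasU P Q (i + 1) * lucasU P Q (i + d) - lucasU P Q i * lucasU P Q (i + d + 1) =
      Q ^ i * lucasU P Q d := by
  induction i with
  | zero => simp [lucasU]
  | succ i ih =>
    have e : i + 1 + d = i + d + 1 := by ring
    rw [e, pow_succ' Q, mul_assoc, ← ih]
    simp only [lucasU]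
    ring

theorem not_dvd_pow_of_not_dvd {p : ℕ} (hp : p.Prime) {a : ℤ} (ha : ¬ (p : ℤ) ∣ a) (n : ℕ) :
    ¬ (p : ℤ) ∣ a ^ n := fun h => ha ((Nat.prime_iff_prime_int.mp hp).dvd_of_dvd_pow h)

theorem not_dvd_mul_of_not_dvd {p : ℕ} (hp : p.Prime) {a b : ℤ} (ha : ¬ (p : ℤ) ∣ a)
    (hb : ¬ (p : ℤ) ∣ b) : ¬ (p : ℤ) ∣ a * b := fun h =>
  ((Nat.prime_iff_prime_int.mp hp).dvd_or_dvd h).elim ha hb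

theorem not_dvd_lucasU_succ {p : ℕ} (hp : p.Prime) {P Q : ℤ} (hQ : ¬ (p : ℤ) ∣ Q) {m : ℕ}
    (hm : (p : ℤ) ∣ lucasU P Q m) : ¬ (p : ℤ) ∣ lucasU P Q (m + 1) := by
  intro h
  refine not_dvd_pow_of_not_dvd hp hQ m ?_
  rw [← lucasU_norm P Q m]
  exact dvd_add (dvd_sub (dvd_pow h two_ne_zero) (Dvd.dvd.mul_left h _))
    (Dvd.dvd.mul_left (dvd_pow hm two_ne_zero) _)

theorem dvd_lucasU_add_iff {p : ℕ} (hp : p.Prime) {P Q : ℤ} (hQ : ¬ (p : ℤ) ∣ Q) {m : ℕ}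
    (hm : (p : ℤ) ∣ lucasU P Q m) (d : ℕ) :
    (p : ℤ) ∣ lucasU P Q (m + d) ↔ (p : ℤ) ∣ lucasU P Q d := by
  have h := lucasU_dOcagne P Q m d
  have hpi := Nat.prime_iff_prime_int.mp hp
  constructor
  · intro hd
    have h1 : (p : ℤ) ∣ Q ^ m * lucasU P Q d :=
      h ▸ dvd_sub (Dvd.dvd.mul_left hd _) (Dvd.dvd.mul_right hm _)
    exact (hpi.dvd_or_dvd h1).resolve_left (not_dvd_pow_of_not_dvd hp hQ m)
  · intro hd
    have h1 : (p : ℤ) ∣ lucasU P Q (m + 1) * lucasU P Q (m + d) := by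
      rw [sub_eq_iff_eq_add.mp h]
      exact dvd_add (Dvd.dvd.mul_left hd _) (Dvd.dvd.mul_right hm _)
    exact (hpi.dvd_or_dvd h1).resolve_left (not_dvd_lucasU_succ hp hQ hm)

/-- Pigeonhole on consecutive pairs modulo p: if the pairs at i and i + d agree, d'Ocagne's identity
gives p ∣ Q^i U_d. -/
theorem exists_dvd_lucasU {p : ℕ} (hp : p.Prime) {P Q : ℤ} (hQ : ¬ (p : ℤ) ∣ Q) :
    ∃ n, 1 ≤ n ∧ (p : ℤ) ∣ lucasU P Q n := by
  have := Fact.mk hp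
  obtain ⟨i, j, hij, h⟩ := Finite.exists_ne_map_eq_of_infinite
    fun n => ((lucasU P Q n : ZMod p), (lucasU P Q (n + 1) : ZMod p))
  wlog hlt : i < j generalizing i j
  · exact this j i hij.symm h.symm (by omega)
  obtain ⟨d, rfl⟩ := Nat.exists_eq_add_of_lt hlt
  refine ⟨d + 1, by omega, ?_⟩
  obtain ⟨h1, h2⟩ := Prod.mk.inj h
  have h3 := congrArg (Int.cast : ℤ → ZMod p) (lucasU_dOcagne P Q i (d + 1))
  push_cast at h3
  rw [← add_assoc, ← h1, ← h2, mul_comm, sub_self, eq_comm, ← Int.cast_pow, ← Int.cast_mul,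
    ZMod.intCast_zmod_eq_zero_iff_dvd] at h3
  exact ((Nat.prime_iff_prime_int.mp hp).dvd_or_dvd h3).resolve_left
    (not_dvd_pow_of_not_dvd hp hQ i)

theorem isLeast_entryPoint {p : ℕ} (hp : p.Prime) {P Q : ℤ} (hQ : ¬ (p : ℤ) ∣ Q) :
    IsLeast {n : ℕ | 1 ≤ n ∧ (p : ℤ) ∣ lucasU P Q n} (entryPoint (lucasU P Q) p) :=
  ⟨Nat.sInf_mem (exists_dvd_lucasU hp hQ), fun _ hn => Nat.sInf_le hn⟩

theorem dvd_lucasU_iff {p : ℕ} (hp : p.Prime) {P Q : ℤ} (hQ : ¬ (p : ℤ) ∣ Q) {z : ℕ}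
    (hz : IsLeast {n : ℕ | 1 ≤ n ∧ (p : ℤ) ∣ lucasU P Q n} z) (n : ℕ) :
    (p : ℤ) ∣ lucasU P Q n ↔ z ∣ n := by
  induction n using Nat.strong_induction_on with
  | _ n ih =>
    rcases Nat.lt_or_ge n z with h | h
    · rcases Nat.eq_zero_or_pos n with rfl | h0
      · simp [lucasU]
      · refine iff_of_false (fun hd => ?_) (Nat.not_dvd_of_pos_of_lt h0 h)
        exact absurd (hz.2 ⟨h0, hd⟩) (by omega)
    · obtain ⟨d, rfl⟩ := Nat.exists_eq_add_of_le h
      have := hz.1.1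
      rw [dvd_lucasU_add_iff hp hQ hz.1.2, ih d (by omega), Nat.dvd_add_right (dvd_refl z)]

theorem two_dvd_of_two_dvd_lucasD {P Q : ℤ} (h : (2 : ℤ) ∣ lucasD P Q) : (2 : ℤ) ∣ P := by
  have h2 : (2 : ℤ) ∣ lucasD P Q + 4 * Q := dvd_add h (Dvd.dvd.mul_right (by norm_num) _)
  rw [lucasD, sub_add_cancel] at h2
  exact Int.prime_two.dvd_of_dvd_pow h2

/-- If `p ∣ D` and `p ∤ Q`, the rank of apparition of `p` is `p`. -/
theorem isLeast_prime_of_dvd_lucasD {p : ℕ} (hp : p.Prime) {P Q : ℤ} (hQ : ¬ (p : ℤ) ∣ Q)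
    (hD : (p : ℤ) ∣ lucasD P Q) :
    IsLeast {n : ℕ | 1 ≤ n ∧ (p : ℤ) ∣ lucasU P Q n} p := by
  have := Fact.mk hp
  have hU : (p : ℤ) ∣ lucasU P Q p := by
    rcases hp.eq_two_or_odd' with rfl | hodd
    · simpa [lucasU] using two_dvd_of_two_dvd_lucasD hD
    · have h2 : (2 : ZMod p) ≠ 0 := by
        intro h
        have : p ∣ 2 := (ZMod.natCast_eq_zero_iff 2 p).mp (by exact_mod_cast h)
        have := (Nat.prime_dvd_prime_iff_eq hp Nat.prime_two).mp this
        subst this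
        exact absurd hodd (by decide)
      have hD' : (P : ZMod p) ^ 2 - 4 * Q = 0 := by
        have := (ZMod.intCast_zmod_eq_zero_iff_dvd _ p).mpr hD
        rw [lucasD] at this
        exact_mod_cast this
      -- Modulo p the characteristic polynomial has the double root r, so U_{n+1} = (n+1) r^n, which
      -- vanishes at n = p - 1.
      obtain ⟨r, hr⟩ : ∃ r : ZMod p, (P : ZMod p) = 2 * r := ⟨P / 2, by field_simp⟩
      have hr2 : (Q : ZMod p) = r ^ 2 := by
        have h4 : (2 : ZMod p) ^ 2 * ((Q : ZMod p) - r ^ 2) = 0 := by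
          rw [hr] at hD'
          linear_combination -hD'
        exact sub_eq_zero.mp ((mul_eq_zero.mp h4).resolve_left (pow_ne_zero _ h2))
      have key : ∀ n : ℕ, (lucasU P Q (n + 1) : ZMod p) = (n + 1) * r ^ n := by
        intro n
        induction n using Nat.twoStepInduction with
        | zero => simp [lucasU]
        | one => norm_num [lucasU, hr]
        | more n h0 h1 =>
          rw [lucasU]
          push_cast at h1 ⊢
          rw [h1, h0, hr, hr2]
          ring
      rw [← ZMod.intCast_zmod_eq_zero_iff_dvd]
      have h5 := key (p - 1)
      have h6 : ((p - 1 : ℕ) : ZMod p) + 1 = 0 := by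
        rw [← Nat.cast_add_one, Nat.sub_add_cancel hp.one_le, ZMod.natCast_self]
      rwa [h6, zero_mul, Nat.sub_add_cancel hp.one_le] at h5
  have hz := isLeast_entryPoint (P := P) hp hQ
  have hd := (dvd_lucasU_iff hp hQ hz p).mp hU
  rcases (Nat.dvd_prime hp).mp hd with h | h
  · have h1 := hz.1.2
    rw [h] at h1
    exact absurd h1 (by
      simpa [lucasU] using fun h => (Nat.prime_iff_prime_int.mp hp).not_isUnit (isUnit_of_dvd_one h))
  · rwa [h] at hz

/-! ### Valuations at a prime not dividing `Q` -/

theorem not_dvd_lucasU_succ_sub {p : ℕ} (hp : p.Prime) {P Q : ℤ} (hQ : ¬ (p : ℤ) ∣ Q) {m : ℕ}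
    (hm : (p : ℤ) ∣ lucasU P Q m) : ¬ (p : ℤ) ∣ lucasU P Q (m + 1) - P * lucasU P Q m := fun h =>
  not_dvd_lucasU_succ hp hQ hm ((dvd_sub_left (Dvd.dvd.mul_left hm _)).mp h)

theorem lucasU_mul_eq {P Q : ℤ} (hD : lucasD P Q ≠ 0) {t : ℕ} (ht : 1 ≤ t) (m : ℕ) :
    lucasU P Q (t * m) = lucasU P Q m *
      (t * (lucasU P Q (m + 1) - P * lucasU P Q m) ^ (t - 1) +
        ∑ k ∈ Finset.Ico 2 (t + 1), (t.choose k : ℤ) *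
          (lucasU P Q (m + 1) - P * lucasU P Q m) ^ (t - k) * lucasU P Q m ^ (k - 1) *
            lucasU P Q k) := by
  rw [lucasU_mul_eq_sum hD, Finset.range_eq_Ico, Finset.sum_eq_sum_Ico_succ_bot (by omega),
    Finset.sum_eq_sum_Ico_succ_bot (by omega), mul_add, Finset.mul_sum]
  simp only [lucasU, mul_zero, zero_add, Nat.choose_one_right, pow_one, mul_one]
  congr 1
  · ring
  · refine Finset.sum_congr rfl fun k hk => ?_
    obtain ⟨j, rfl⟩ := Nat.exists_eq_add_of_le (Finset.mem_Ico.mp hk).1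
    rw [show 2 + j - 1 = j + 1 by omega, show 2 + j = j + 1 + 1 by omega,
      pow_succ (lucasU P Q m) (j + 1)]
    ring

theorem padicValInt_lucasU_mul {p : ℕ} [hp : Fact p.Prime] {P Q : ℤ} (hPQ : LucasNondegenerate P Q)
    (hQ : ¬ (p : ℤ) ∣ Q) {m t : ℕ} (hm1 : 1 ≤ m) (hm : (p : ℤ) ∣ lucasU P Q m) (ht : ¬ p ∣ t) :
    padicValInt p (lucasU P Q (t * m)) = padicValInt p (lucasU P Q m) := by
  have ht1 : 1 ≤ t := Nat.one_le_iff_ne_zero.mpr (by rintro rfl; simp at ht)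
  rw [lucasU_mul_eq hPQ.D_ne_zero ht1]
  refine padicValInt_mul_of_not_dvd (hPQ.U_ne_zero m hm1) ?_
  rw [dvd_add_left]
  · exact not_dvd_mul_of_not_dvd hp.out (by exact_mod_cast ht)
      (not_dvd_pow_of_not_dvd hp.out (not_dvd_lucasU_succ_sub hp.out hQ hm) _)
  · refine Finset.dvd_sum fun k hk => ?_
    have := (Finset.mem_Ico.mp hk).1
    exact Dvd.dvd.mul_right (Dvd.dvd.mul_left (dvd_pow hm (by omega)) _) _

/-- An integer of the form `p * a + b` with `p ∤ a`, `p ^ 2 ∣ b` is exactly divisible by `p`. -/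
theorem exists_eq_prime_mul_of_sq_dvd {p : ℕ} {a b : ℤ} (ha : ¬ (p : ℤ) ∣ a)
    (hb : (p : ℤ) ^ 2 ∣ b) : ∃ c : ℤ, p * a + b = p * c ∧ ¬ (p : ℤ) ∣ c := by
  obtain ⟨d, rfl⟩ := hb
  refine ⟨a + p * d, by ring, fun h => ha ?_⟩
  exact (dvd_add_left (dvd_mul_right _ _)).mp h

/-- The cofactor of U_m is p c^(p-1) modulo p². The only term that could spoil this is k = p = 2,
equal to P U_m, which `h2` makes divisible by 4. -/
theorem padicValInt_lucasU_prime_mul {p : ℕ} [hp : Fact p.Prime] {P Q : ℤ}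
    (hPQ : LucasNondegenerate P Q) (hQ : ¬ (p : ℤ) ∣ Q) {m : ℕ} (hm1 : 1 ≤ m)
    (hm : (p : ℤ) ∣ lucasU P Q m)
    (h2 : p ≠ 2 ∨ (p : ℤ) ∣ P ∨ (p : ℤ) ^ 2 ∣ lucasU P Q m) :
    padicValInt p (lucasU P Q (p * m)) = padicValInt p (lucasU P Q m) + 1 := by
  rw [lucasU_mul_eq hPQ.D_ne_zero hp.out.one_le]
  obtain ⟨c, hc, hpc⟩ := exists_eq_prime_mul_of_sq_dvd (p := p)
    (not_dvd_pow_of_not_dvd hp.out (not_dvd_lucasU_succ_sub hp.out hQ hm) (p - 1))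
    (b := ∑ k ∈ Finset.Ico 2 (p + 1), (p.choose k : ℤ) *
          (lucasU P Q (m + 1) - P * lucasU P Q m) ^ (p - k) * lucasU P Q m ^ (k - 1) *
            lucasU P Q k) (by
    refine Finset.dvd_sum fun k hk => ?_
    obtain ⟨hk2, hkp⟩ := Finset.mem_Ico.mp hk
    rcases Nat.lt_or_ge k p with hlt | hge
    · rw [sq]
      refine Dvd.dvd.mul_right (mul_dvd_mul (Dvd.dvd.mul_right ?_ _)
        (dvd_pow hm (by omega))) _
      exact_mod_cast hp.out.dvd_choose_self (by omega) hlt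
    · obtain rfl : k = p := by omega
      rcases Nat.lt_or_ge 2 k with h3 | h3
      · exact Dvd.dvd.mul_right (Dvd.dvd.mul_left
          ((pow_dvd_pow_of_dvd hm 2).trans (pow_dvd_pow _ (by omega))) _) _
      · obtain rfl : k = 2 := by omega
        rw [mul_assoc]
        refine Dvd.dvd.mul_left ?_ _
        simp only [lucasU, mul_one, mul_zero, sub_zero, Nat.add_one_sub_one, pow_one]
        rcases h2 with h | h | h
        · exact absurd rfl h
        · rw [sq]; exact mul_dvd_mul hm h
        · exact Dvd.dvd.mul_right h _)
  rw [hc, ← mul_assoc, padicValInt_mul_of_not_dvd _ hpc, padicValInt.mul,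
    padicValInt.self hp.out.one_lt]
  · exact hPQ.U_ne_zero m hm1
  · exact_mod_cast hp.out.ne_zero
  · exact mul_ne_zero (hPQ.U_ne_zero m hm1) (by exact_mod_cast hp.out.ne_zero)

theorem lucasU_dvd_mul {P Q : ℤ} (hD : lucasD P Q ≠ 0) (t m : ℕ) :
    lucasU P Q m ∣ lucasU P Q (t * m) := by
  rcases Nat.eq_zero_or_pos t with rfl | ht
  · simp [lucasU]
  · rw [lucasU_mul_eq hD ht]
    exact dvd_mul_right _ _

/-- For p = 2, this makes every step after z → 2z regular, so only the weight at k = 1 can be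
irregular. -/
theorem four_dvd_lucasU_two_mul {P Q : ℤ} (hD : lucasD P Q ≠ 0) {m : ℕ}
    (hm : (2 : ℤ) ∣ lucasU P Q m) : (2 : ℤ) ^ 2 ∣ lucasU P Q (2 * m) := by
  rw [lucasU_mul_eq hD one_le_two, sq]
  refine mul_dvd_mul hm (dvd_add (Dvd.dvd.mul_right (by norm_num) _)
    (Finset.dvd_sum fun k hk => ?_))
  have := (Finset.mem_Ico.mp hk).1
  exact Dvd.dvd.mul_right (Dvd.dvd.mul_left (dvd_pow hm (by omega)) _) _

theorem padicValInt_lucasU_pow_mul {p : ℕ} [hp : Fact p.Prime] {P Q : ℤ}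
    (hPQ : LucasNondegenerate P Q) (hQ : ¬ (p : ℤ) ∣ Q) {z : ℕ} (hz1 : 1 ≤ z)
    (hz : (p : ℤ) ∣ lucasU P Q z) (k : ℕ) :
    padicValInt p (lucasU P Q (p ^ (k + 1) * z)) = padicValInt p (lucasU P Q (p * z)) + k := by
  induction k with
  | zero => simp
  | succ k ih =>
    have hpos : 1 ≤ p ^ (k + 1) * z := Nat.mul_pos (pow_pos hp.out.pos _) hz1
    rw [pow_succ', mul_assoc, padicValInt_lucasU_prime_mul hPQ hQ hpos
      (hz.trans (lucasU_dvd_mul hPQ.D_ne_zero _ _)), ih]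
    · ring
    · rcases eq_or_ne p 2 with rfl | h
      · refine Or.inr (Or.inr ((four_dvd_lucasU_two_mul hPQ.D_ne_zero hz).trans ?_))
        rw [pow_succ, mul_assoc]
        exact lucasU_dvd_mul hPQ.D_ne_zero _ _
      · exact Or.inl h

/-- The valuations of the Möbius dual along `p ^ k * z`, with `z` the rank of apparition. -/
def lucasWeight (p z : ℕ) (P Q : ℤ) : ℕ → ℤ
  | 0 => padicValInt p (lucasU P Q z)
  | 1 => padicValInt p (lucasU P Q (p * z)) - padicValInt p (lucasU P Q z)
  | _ + 2 => 1

theorem sum_lucasWeight (p z : ℕ) (P Q : ℤ) (k : ℕ) :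
    ∑ j ∈ Finset.range (k + 2), lucasWeight p z P Q j =
      padicValInt p (lucasU P Q (p * z)) + k := by
  induction k with
  | zero => simp [Finset.sum_range_succ, lucasWeight]
  | succ k ih =>
    rw [Finset.sum_range_succ, ih, lucasWeight]
    push_cast
    ring

theorem padicValInt_lucasU_eq_sum {p : ℕ} [hp : Fact p.Prime] {P Q : ℤ}
    (hPQ : LucasNondegenerate P Q) (hQ : ¬ (p : ℤ) ∣ Q) {z : ℕ} (hz1 : 1 ≤ z)
    (hz : (p : ℤ) ∣ lucasU P Q z) {t : ℕ} (ht : ¬ p ∣ t) (k : ℕ) :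
    (padicValInt p (lucasU P Q (p ^ k * t * z)) : ℤ) =
      ∑ j ∈ Finset.range (k + 1), lucasWeight p z P Q j := by
  rw [mul_comm (p ^ k), mul_assoc, padicValInt_lucasU_mul hPQ hQ
    (Nat.mul_pos (pow_pos hp.out.pos _) hz1) (hz.trans (lucasU_dvd_mul hPQ.D_ne_zero _ _)) ht]
  cases k with
  | zero => simp [lucasWeight]
  | succ k =>
    rw [padicValInt_lucasU_pow_mul hPQ hQ hz1 hz, sum_lucasWeight]
    push_cast
    ring

theorem padicValRat_moebiusDual_lucasU {p : ℕ} [hp : Fact p.Prime] {P Q : ℤ}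
    (hPQ : LucasNondegenerate P Q) (hQ : ¬ (p : ℤ) ∣ Q) {z : ℕ}
    (hz : IsLeast {n : ℕ | 1 ≤ n ∧ (p : ℤ) ∣ lucasU P Q n} z) {n : ℕ} (hn : 1 ≤ n) :
    padicValRat p (moebiusDual (lucasU P Q) n) =
      primePowerSupport p z (lucasWeight p z P Q) n := by
  refine padicValRat_moebiusDual_eq hPQ.U_ne_zero (fun n hn => ?_) hn
  by_cases h : z ∣ n
  · obtain ⟨m, rfl⟩ := h
    obtain ⟨k, t, ht, rfl⟩ := Nat.exists_eq_pow_mul_and_not_dvd (n := m)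
      (by rintro rfl; simp at hn) p hp.out.ne_one
    rw [mul_comm z, sum_divisors_primePowerSupport hp.out hz.1.1 ht,
      padicValInt_lucasU_eq_sum hPQ hQ hz.1.1 hz.1.2 ht]
  · rw [sum_divisors_primePowerSupport_of_not_dvd h, padicValInt.eq_zero_of_not_dvd]
    · rfl
    · rwa [dvd_lucasU_iff hp.out hQ hz]

/-! ### Primes dividing exactly one of `Q` and `D` -/

theorem not_dvd_lucasU_of_dvd {p : ℕ} (hp : p.Prime) {P Q : ℤ} (hP : ¬ (p : ℤ) ∣ P)
    (hQ : (p : ℤ) ∣ Q) (n : ℕ) : ¬ (p : ℤ) ∣ lucasU P Q (n + 1) := by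
  induction n with
  | zero => simpa [lucasU] using fun h =>
      (Nat.prime_iff_prime_int.mp hp).not_isUnit (isUnit_of_dvd_one h)
  | succ n ih =>
    rw [lucasU, dvd_sub_left (Dvd.dvd.mul_right hQ _)]
    exact not_dvd_mul_of_not_dvd hp hP ih

theorem padicValRat_moebiusDual_lucasU_of_dvd {p : ℕ} [hp : Fact p.Prime] {P Q : ℤ}
    (hPQ : LucasNondegenerate P Q) (hP : ¬ (p : ℤ) ∣ P) (hQ : (p : ℤ) ∣ Q) {n : ℕ} (hn : 1 ≤ n) :
    padicValRat p (moebiusDual (lucasU P Q) n) = 0 := by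
  refine padicValRat_moebiusDual_eq (g := fun _ => 0) hPQ.U_ne_zero (fun n hn => ?_) hn
  obtain ⟨m, rfl⟩ := Nat.exists_eq_add_of_le' hn
  rw [padicValInt.eq_zero_of_not_dvd (not_dvd_lucasU_of_dvd hp.out hP hQ m)]
  simp

theorem lucasWeight_succ_of_dvd_lucasD {p : ℕ} [hp : Fact p.Prime] {P Q : ℤ}
    (hPQ : LucasNondegenerate P Q) (hQ : ¬ (p : ℤ) ∣ Q) (hD : (p : ℤ) ∣ lucasD P Q) (k : ℕ) :
    lucasWeight p p P Q (k + 1) = 1 := by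
  cases k with
  | succ k => rfl
  | zero =>
    rw [zero_add, lucasWeight, padicValInt_lucasU_prime_mul hPQ hQ hp.out.one_le
      (isLeast_prime_of_dvd_lucasD hp.out hQ hD).1.2]
    · push_cast; ring
    · rcases eq_or_ne p 2 with rfl | h
      · exact Or.inr (Or.inl (two_dvd_of_two_dvd_lucasD hD))
      · exact Or.inl h

theorem dvd_lucasU_add_two {a P Q : ℤ} (hP : a ∣ P) (hQ : a ∣ Q) (n : ℕ) :
    a ∣ lucasU P Q (n + 2) :=
  dvd_sub (Dvd.dvd.mul_right hP _) (Dvd.dvd.mul_right hQ _)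

theorem sq_dvd_lucasU_add_four {a P Q : ℤ} (hP : a ∣ P) (hQ : a ∣ Q) (n : ℕ) :
    a ^ 2 ∣ lucasU P Q (n + 4) := by
  rw [sq]
  exact dvd_sub (mul_dvd_mul hP (dvd_lucasU_add_two hP hQ (n + 1)))
    (mul_dvd_mul hQ (dvd_lucasU_add_two hP hQ n))

/-- Translating the roots by a lift r of their double value mod p makes both parameters divisible by
p. Then U_p ≡ p r^(p-1) mod p²: for 2 ≤ k < p both the binomial and the shifted U_k contribute a
factor p, while for k = p the shifted U_p is divisible by p² because p ≥ 4. -/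
theorem padicValInt_lucasU_prime_of_dvd_lucasD {p : ℕ} [hp : Fact p.Prime] (hp4 : 4 ≤ p) {P Q : ℤ}
    (hD0 : lucasD P Q ≠ 0) (hQ : ¬ (p : ℤ) ∣ Q) (hD : (p : ℤ) ∣ lucasD P Q) :
    padicValInt p (lucasU P Q p) = 1 := by
  have hpi := Nat.prime_iff_prime_int.mp hp.out
  obtain ⟨q, hq⟩ := hp.out.odd_of_ne_two (by omega)
  have hq' : (p : ℤ) = 2 * q + 1 := by exact_mod_cast hq
  -- Here q + 1 is the inverse of 2 modulo p, so r ≡ P/2.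
  set r : ℤ := P * (q + 1) with hr
  have h1 : (p : ℤ) ∣ P - 2 * r := ⟨-P, by rw [hr, hq']; ring⟩
  have h2 : (p : ℤ) ∣ Q - r * P + r ^ 2 := by
    have h3 : (p : ℤ) ∣ 2 ^ 2 * (Q - r * P + r ^ 2) := by
      have : 2 ^ 2 * (Q - r * P + r ^ 2) = p * (p * P ^ 2) - lucasD P Q := by
        rw [hr, hq', lucasD]; ring
      rw [this]
      exact dvd_sub (dvd_mul_right _ _) hD
    refine (hpi.dvd_or_dvd h3).resolve_left fun h => ?_
    have h4 : p ∣ 2 := by exact_mod_cast hpi.dvd_of_dvd_pow h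
    exact absurd (Nat.le_of_dvd two_pos h4) (by omega)
  have hrp : ¬ (p : ℤ) ∣ r := fun h => hQ (by
    have : Q = (Q - r * P + r ^ 2) + r * (P - r) := by ring
    rw [this]
    exact dvd_add h2 (Dvd.dvd.mul_right h _))
  rw [lucasU_shift hD0 r, Finset.range_eq_Ico, Finset.sum_eq_sum_Ico_succ_bot (by omega),
    Finset.sum_eq_sum_Ico_succ_bot (by omega)]
  obtain ⟨c, hc, hpc⟩ := exists_eq_prime_mul_of_sq_dvd (p := p)
    (not_dvd_pow_of_not_dvd hp.out hrp (p - 1))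
    (b := ∑ k ∈ Finset.Ico 2 (p + 1), (p.choose k : ℤ) * r ^ (p - k) *
      lucasU (P - 2 * r) (Q - r * P + r ^ 2) k) (by
    refine Finset.dvd_sum fun k hk => ?_
    obtain ⟨hk2, hkp⟩ := Finset.mem_Ico.mp hk
    rcases Nat.lt_or_ge k p with hlt | hge
    · obtain ⟨j, rfl⟩ := Nat.exists_eq_add_of_le' hk2
      rw [sq]
      refine mul_dvd_mul (Dvd.dvd.mul_right ?_ _) (dvd_lucasU_add_two h1 h2 j)
      exact_mod_cast hp.out.dvd_choose_self (by omega) hlt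
    · obtain ⟨j, rfl⟩ := Nat.exists_eq_add_of_le' (hp4.trans hge)
      exact Dvd.dvd.mul_left (sq_dvd_lucasU_add_four h1 h2 j) _)
  simp only [lucasU, mul_zero, zero_add, Nat.choose_one_right, mul_one, Nat.reduceAdd]
  rw [hc, padicValInt_mul_of_not_dvd (by exact_mod_cast hp.out.ne_zero) hpc,
    padicValInt.self hp.out.one_lt]

/-! ### Primes dividing both parameters -/

theorem LucasNondegenerate.of_scale {a P Q : ℤ} (h : LucasNondegenerate (a * P) (a ^ 2 * Q)) :
    LucasNondegenerate P Q where
  P_ne_zero := right_ne_zero_of_mul h.P_ne_zero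
  Q_ne_zero := right_ne_zero_of_mul h.Q_ne_zero
  D_ne_zero := by
    refine right_ne_zero_of_mul (a := a ^ 2) ?_
    convert h.D_ne_zero using 1
    rw [lucasD, lucasD]; ring
  U_ne_zero n hn := by
    obtain ⟨m, rfl⟩ := Nat.exists_eq_add_of_le' hn
    exact right_ne_zero_of_mul (lucasU_scale a P Q m ▸ h.U_ne_zero (m + 1) hn)
  V_ne_zero n hn := right_ne_zero_of_mul (lucasV_scale a P Q n ▸ h.V_ne_zero n hn)

/-- The exponent r(n-1) is the divisor sum of r φ(d), less r at d = 1. -/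
theorem padicValRat_moebiusDual_lucasU_scale {p : ℕ} [Fact p.Prime] {P Q : ℤ} (r : ℕ)
    (h : LucasNondegenerate ((p : ℤ) ^ r * P) (((p : ℤ) ^ r) ^ 2 * Q)) {n : ℕ} (hn : 1 ≤ n) :
    padicValRat p (moebiusDual (lucasU ((p : ℤ) ^ r * P) (((p : ℤ) ^ r) ^ 2 * Q)) n) =
      n.totient * r + padicValRat p (moebiusDual (lucasU P Q) n) - if n = 1 then (r : ℤ) else 0 := by
  refine padicValRat_moebiusDual_eq
    (g := fun n => n.totient * r + padicValRat p (moebiusDual (lucasU P Q) n) -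
      if n = 1 then (r : ℤ) else 0) h.U_ne_zero (fun n hn => ?_) hn
  rw [Finset.sum_sub_distrib, Finset.sum_add_distrib, ← Finset.sum_mul, ← Nat.cast_sum,
    Nat.sum_totient, sum_divisors_padicValRat_moebiusDual h.of_scale.U_ne_zero hn,
    Finset.sum_ite_eq', if_pos (by simp; omega)]
  obtain ⟨m, rfl⟩ := Nat.exists_eq_add_of_le' hn
  rw [lucasU_scale, ← pow_mul, padicValInt_pow_mul (h.of_scale.U_ne_zero _ hn)]
  push_cast
  ring

theorem lucasV_two_mul {P Q : ℤ} (m : ℕ) :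
    lucasV P Q (2 * m) = lucasV (P ^ 2 - 2 * Q) (Q ^ 2) m := by
  induction m using Nat.twoStepInduction with
  | zero => simp [lucasV]
  | one => simp [lucasV]; ring
  | more m h0 h1 =>
    rw [lucasV.eq_3 (P ^ 2 - 2 * Q), ← h0, ← h1]
    have e : 2 * (m + 2) = (2 * m + 2) + 2 := by ring
    have e1 : 2 * (m + 1) = 2 * m + 2 := by ring
    rw [e, e1]
    simp only [lucasV]
    ring

theorem LucasNondegenerate.two_mul {P Q : ℤ} (h : LucasNondegenerate P Q) :
    LucasNondegenerate (P ^ 2 - 2 * Q) (Q ^ 2) where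
  P_ne_zero := by
    convert h.V_ne_zero 2 (by norm_num) using 1
    simp only [lucasV]; ring
  Q_ne_zero := pow_ne_zero _ h.Q_ne_zero
  D_ne_zero := by
    convert mul_ne_zero (pow_ne_zero 2 h.P_ne_zero) h.D_ne_zero using 1
    rw [lucasD, lucasD]; ring
  U_ne_zero m hm := right_ne_zero_of_mul (lucasU_two_mul m ▸ h.U_ne_zero (2 * m) (by omega))
  V_ne_zero m hm := lucasV_two_mul m ▸ h.V_ne_zero (2 * m) (by omega)

/-- φ(d) is even except at d = 1, 2, so the halves sum to ⌊(n-1)/2⌋. -/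
theorem two_mul_sum_totient_div_two {n : ℕ} (hn : 1 ≤ n) :
    2 * ∑ d ∈ n.divisors, ((d.totient / 2 : ℕ) : ℤ) + 1 + (if 2 ∣ n then 1 else 0) = n := by
  have h : ∀ d ∈ n.divisors, (d.totient : ℤ) =
      2 * ((d.totient / 2 : ℕ) : ℤ) + (if d = 1 then 1 else 0) + (if d = 2 then 1 else 0) := by
    intro d hd
    have hd0 := Nat.pos_of_mem_divisors hd
    rcases Nat.lt_or_ge 2 d with h2 | h2
    · have := Nat.div_mul_cancel (Nat.totient_even h2).two_dvd
      rw [if_neg (by omega), if_neg (by omega)]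
      omega
    · interval_cases d <;> simp
  have h2 : (n : ℤ) = ∑ d ∈ n.divisors, (d.totient : ℤ) := by
    rw [← Nat.cast_sum, Nat.sum_totient]
  rw [h2, Finset.sum_congr rfl h, Finset.sum_add_distrib, Finset.sum_add_distrib,
    Finset.sum_ite_eq', Finset.sum_ite_eq', ← Finset.mul_sum,
    if_pos (Nat.one_mem_divisors.mpr (by omega))]
  simp [show n ≠ 0 by omega]

theorem lucasU_even_eq {p s : ℕ} {P Q Q' R : ℤ} (hQ : Q = (p : ℤ) ^ s * Q')
    (hP : P ^ 2 = (p : ℤ) ^ (s + 1) * R) (m : ℕ) :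
    lucasU P Q (2 * (m + 1)) =
      P * ((p : ℤ) ^ (s * m) * lucasU (p * R - 2 * Q') (Q' ^ 2) (m + 1)) := by
  rw [lucasU_two_mul, pow_mul, ← lucasU_scale, hP, hQ]
  ring_nf

theorem lucasNondegenerate_even_part {p s : ℕ} {P Q Q' R : ℤ} (h : LucasNondegenerate P Q)
    (hQ : Q = (p : ℤ) ^ s * Q') (hP : P ^ 2 = (p : ℤ) ^ (s + 1) * R) : LucasNondegenerate (p * R - 2 * Q') (Q' ^ 2) := by
  refine LucasNondegenerate.of_scale (a := (p : ℤ) ^ s) ?_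
  convert h.two_mul using 1
  · rw [hP, hQ]; ring
  · rw [hQ]; ring

section
variable {p : ℕ} [hp : Fact p.Prime] {P Q Q' R : ℤ} {s : ℕ}

/-- The even term is carried along so that P · P supplies p^(s+1); hence x is multiplied by -Q'
modulo p at each step and stays prime to p. -/
theorem exists_lucasU_odd_eq (hQ : Q = (p : ℤ) ^ s * Q') (hP : P ^ 2 = (p : ℤ) ^ (s + 1) * R)
    (hQ' : ¬ (p : ℤ) ∣ Q') (k : ℕ) : ∃ x y : ℤ, lucasU P Q (2 * k + 1) = (p : ℤ) ^ (s * k) * x ∧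
      lucasU P Q (2 * k + 2) = P * ((p : ℤ) ^ (s * k) * y) ∧ ¬ (p : ℤ) ∣ x := by
  induction k with
  | zero =>
    exact ⟨1, 1, by simp [lucasU], by simp [lucasU], fun h =>
      (Nat.prime_iff_prime_int.mp hp.out).not_isUnit (isUnit_of_dvd_one h)⟩
  | succ k ih =>
    obtain ⟨x, y, hx, hy, hpx⟩ := ih
    have h1 : lucasU P Q (2 * k + 3) = (p : ℤ) ^ (s * (k + 1)) * (p * (R * y) - Q' * x) := by
      have hP' : P * P = (p : ℤ) ^ (s + 1) * R := by rw [← sq, hP]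
      rw [lucasU, hy, hx, ← mul_assoc P P, hP', hQ]
      ring
    refine ⟨p * (R * y) - Q' * x, p * (R * y) - Q' * x - Q' * y, h1, ?_, ?_⟩
    · rw [show 2 * (k + 1) + 2 = (2 * k + 2) + 2 by ring, lucasU, h1, hy, hQ]
      ring
    · rw [dvd_sub_right (dvd_mul_right _ _)]
      exact not_dvd_mul_of_not_dvd hp.out hQ' hpx

/-- The corrections to `⌊φ(n) / 2⌋ * v_p(Q)` at `n = 2 * p ^ k`. -/
def evenWeight (p : ℕ) (P P₂ Q₂ : ℤ) : ℕ → ℤ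
  | 0 => padicValInt p P
  | k + 1 => lucasWeight p p P₂ Q₂ k

theorem padicValRat_moebiusDual_lucasU_of_lt (h : LucasNondegenerate P Q)
    (hQ : Q = (p : ℤ) ^ s * Q') (hP : P ^ 2 = (p : ℤ) ^ (s + 1) * R) (hQ' : ¬ (p : ℤ) ∣ Q')
    {n : ℕ} (hn : 1 ≤ n) :
    padicValRat p (moebiusDual (lucasU P Q) n) = ((n.totient / 2 : ℕ) : ℤ) * s +
      primePowerSupport p 2 (evenWeight p P (p * R - 2 * Q') (Q' ^ 2)) n := by
  have hN := lucasNondegenerate_even_part h hQ hP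
  have hQ2 := not_dvd_pow_of_not_dvd hp.out hQ' 2
  have hD2 : (p : ℤ) ∣ lucasD (p * R - 2 * Q') (Q' ^ 2) :=
    ⟨R * (p * R - 4 * Q'), by rw [lucasD]; ring⟩
  have hz := isLeast_prime_of_dvd_lucasD hp.out hQ2 hD2
  refine padicValRat_moebiusDual_eq (g := fun n => ((n.totient / 2 : ℕ) : ℤ) * s +
      primePowerSupport p 2 (evenWeight p P (p * R - 2 * Q') (Q' ^ 2)) n) h.U_ne_zero
    (fun n hn => ?_) hn
  have hφ := two_mul_sum_totient_div_two hn
  rw [Finset.sum_add_distrib, ← Finset.sum_mul]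
  -- For even n, v_p(U_{2m}) = v_p(P) + s(m-1) plus the valuation at m of the squared-root sequence,
  -- whose rank is p; this shifts the exponents in `evenWeight` by one.
  rcases Nat.even_or_odd' n with ⟨m, rfl | rfl⟩
  · rw [if_pos (dvd_mul_right _ _)] at hφ
    obtain ⟨k, t, ht, hm⟩ := Nat.exists_eq_pow_mul_and_not_dvd (n := m) (by omega) p hp.out.ne_one
    obtain ⟨j, hj⟩ := Nat.exists_eq_add_of_le' (show 1 ≤ m by omega)
    have hφ' : ∑ d ∈ (2 * m).divisors, ((d.totient / 2 : ℕ) : ℤ) = j := by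
      have hn2 : ((2 * m : ℕ) : ℤ) = 2 * j + 2 := by omega
      linarith
    have hU2 := hN.U_ne_zero (j + 1) (by omega)
    have hp0 : (p : ℤ) ≠ 0 := by exact_mod_cast hp.out.ne_zero
    have hv : (padicValInt p (lucasU (p * R - 2 * Q') (Q' ^ 2) m) : ℤ) =
        ∑ i ∈ Finset.range k, lucasWeight p p (p * R - 2 * Q') (Q' ^ 2) i := by
      cases k with
      | zero =>
        rw [pow_zero, one_mul] at hm
        rw [padicValInt.eq_zero_of_not_dvd]
        · simp
        · rwa [dvd_lucasU_iff hp.out hQ2 hz, hm]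
      | succ k =>
        rw [hm, pow_succ p, mul_right_comm, padicValInt_lucasU_eq_sum hN hQ2 hz.1.1 hz.1.2 ht]
    have hS := sum_divisors_primePowerSupport hp.out one_le_two ht
      (evenWeight p P (p * R - 2 * Q') (Q' ^ 2)) k
    rw [← hm, mul_comm m 2, Finset.sum_range_succ'] at hS
    rw [hS, hφ', hj, lucasU_even_eq hQ hP, padicValInt.mul h.P_ne_zero
      (mul_ne_zero (pow_ne_zero _ hp0) hU2), padicValInt_pow_mul hU2, ← hj]
    push_cast
    rw [hv]
    simp only [evenWeight]
    ring
  · rw [if_neg (by omega)] at hφ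
    obtain ⟨x, y, hx, -, hpx⟩ := exists_lucasU_odd_eq hQ hP hQ' m
    have hx0 : x ≠ 0 := by rintro rfl; simp at hpx
    rw [sum_divisors_primePowerSupport_of_not_dvd (by omega), hx, padicValInt_pow_mul hx0,
      padicValInt.eq_zero_of_not_dvd hpx]
    have hφ' : ∑ d ∈ (2 * m + 1).divisors, ((d.totient / 2 : ℕ) : ℤ) = m := by
      have hn2 : ((2 * m + 1 : ℕ) : ℤ) = 2 * m + 1 := by omega
      linarith
    rw [hφ']
    push_cast
    ring

theorem padicValInt_lucasU_even_part (h : LucasNondegenerate P Q) (hQ : Q = (p : ℤ) ^ s * Q')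
    (hP : P ^ 2 = (p : ℤ) ^ (s + 1) * R) (hQ' : ¬ (p : ℤ) ∣ Q') (hp23 : p = 2 ∨ p = 3) :
    R - Q' ≠ 0 ∧
      padicValInt p (lucasU (p * R - 2 * Q') (Q' ^ 2) p) = 1 + padicValInt p (R - Q') := by
  have hp0 : (p : ℤ) ≠ 0 := by exact_mod_cast hp.out.ne_zero
  have hU := (lucasNondegenerate_even_part h hQ hP).U_ne_zero p hp.out.one_le
  obtain ⟨e, he, hU'⟩ : ∃ e, ¬ (p : ℤ) ∣ e ∧
      lucasU (p * R - 2 * Q') (Q' ^ 2) p = (p : ℤ) ^ 1 * (R - Q') * e := by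
    -- U_2 = 2(R - Q'), and U_3 = (3R - 2Q')² - Q'² = 3(R - Q')(3R - Q').
    rcases hp23 with rfl | rfl
    · exact ⟨1, by norm_num, by simp only [lucasU]; push_cast; ring⟩
    · refine ⟨3 * R - Q', ?_, by simp only [lucasU]; push_cast; ring⟩
      rwa [Nat.cast_ofNat, dvd_sub_right (dvd_mul_right _ _)]
  have h0 : R - Q' ≠ 0 := by
    intro h0
    rw [hU', h0] at hU
    simp at hU
  refine ⟨h0, ?_⟩
  rw [hU', padicValInt_mul_of_not_dvd (mul_ne_zero (pow_ne_zero _ hp0) h0) he,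
    padicValInt_pow_mul h0]

end

/-! ### Assembly of the five cases -/

theorem theorem2 (P Q : ℤ) (hPQ : LucasNondegenerate P Q) (p : ℕ) (hp : p.Prime) :
    -- the primes that do not divide both parameters
    (¬ ((p : ℤ) ∣ P ∧ (p : ℤ) ∣ Q) →
      -- (a)
      ((p : ℤ) ∣ Q → ∀ n : ℕ, 1 ≤ n → padicValRat p (moebiusDual (lucasU P Q) n) = 0) ∧
      -- (b)
      ((p : ℤ) ∣ lucasD P Q →
        padicValRat p (moebiusDual (lucasU P Q) p) = (padicValInt p (lucasU P Q p) : ℤ) ∧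
        (∀ k : ℕ, 1 < k → padicValRat p (moebiusDual (lucasU P Q) (p ^ k)) = 1) ∧
        (∀ n : ℕ, 1 ≤ n → (∀ k : ℕ, 1 ≤ k → n ≠ p ^ k) →
          padicValRat p (moebiusDual (lucasU P Q) n) = 0)) ∧
      -- (c), where the entry point exists
      (¬ (p : ℤ) ∣ Q * lucasD P Q →
        IsLeast {n : ℕ | 1 ≤ n ∧ (p : ℤ) ∣ lucasU P Q n} (entryPoint (lucasU P Q) p) ∧
        padicValRat p (moebiusDual (lucasU P Q) (entryPoint (lucasU P Q) p)) =
          (padicValInt p (lucasU P Q (entryPoint (lucasU P Q) p)) : ℤ) ∧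
        padicValRat p (moebiusDual (lucasU P Q) (p * entryPoint (lucasU P Q) p)) =
          (padicValInt p (lucasU P Q (p * entryPoint (lucasU P Q) p)) : ℤ) -
            (padicValInt p (lucasU P Q (entryPoint (lucasU P Q) p)) : ℤ) ∧
        (∀ k : ℕ, 1 < k →
          padicValRat p (moebiusDual (lucasU P Q) (p ^ k * entryPoint (lucasU P Q) p)) = 1) ∧
        (∀ n : ℕ, 1 ≤ n → (∀ k : ℕ, n ≠ p ^ k * entryPoint (lucasU P Q) p) →
          padicValRat p (moebiusDual (lucasU P Q) n) = 0))) ∧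
    -- the primes that divide both parameters
    ((p : ℤ) ∣ P ∧ (p : ℤ) ∣ Q →
      -- (d), where `U^{(p)}` is again nondegenerate
      (2 * padicValInt p P ≤ padicValInt p Q →
        LucasNondegenerate (pFreePart p P) (Q / (p : ℤ) ^ (2 * padicValInt p P)) ∧
        padicValRat p (moebiusDual (lucasU P Q) 1) = 0 ∧
        (∀ n : ℕ, 1 < n →
          padicValRat p (moebiusDual (lucasU P Q) n) =
            (n.totient : ℤ) * (padicValInt p P : ℤ) +
              padicValRat p (moebiusDual (lucasUReduced p P Q) n))) ∧
      -- (e), with natural-number division as the floor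
      (padicValInt p Q < 2 * padicValInt p P →
        padicValRat p (moebiusDual (lucasU P Q) 2) = (padicValInt p P : ℤ) ∧
        (∀ k : ℕ, 1 ≤ k →
          ¬ (2 * padicValInt p P = padicValInt p Q + 1 ∧ (p = 2 ∨ p = 3) ∧ k = 1) →
          padicValRat p (moebiusDual (lucasU P Q) (2 * p ^ k)) =
            (((2 * p ^ k).totient / 2 : ℕ) : ℤ) * (padicValInt p Q : ℤ) + 1) ∧
        (∀ n : ℕ, 1 ≤ n → n ≠ 2 → (∀ k : ℕ, 1 ≤ k → n ≠ 2 * p ^ k) →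
          padicValRat p (moebiusDual (lucasU P Q) n) =
            ((n.totient / 2 : ℕ) : ℤ) * (padicValInt p Q : ℤ)) ∧
        (2 * padicValInt p P = padicValInt p Q + 1 → (p = 2 ∨ p = 3) →
          pFreePart p P ^ 2 - pFreePart p Q ≠ 0 ∧
          padicValRat p (moebiusDual (lucasU P Q) (2 * p)) =
            (padicValInt p Q : ℤ) + 1 +
              (padicValInt p (pFreePart p P ^ 2 - pFreePart p Q) : ℤ)))) := by
  have := Fact.mk hp
  have hpi := Nat.prime_iff_prime_int.mp hp
  refine ⟨fun hnd => ⟨fun hQ n hn => ?_, fun hD => ?_, fun hQD => ?_⟩,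
    fun ⟨hpP, hpQ⟩ => ⟨fun hle => ?_, fun hlt => ?_⟩⟩
  · exact padicValRat_moebiusDual_lucasU_of_dvd hPQ (fun hP => hnd ⟨hP, hQ⟩) hQ hn
  · have hQ : ¬ (p : ℤ) ∣ Q := fun hQ => hnd ⟨hpi.dvd_of_dvd_pow
      ((dvd_sub_left (Dvd.dvd.mul_left hQ 4)).mp hD), hQ⟩
    have hz := isLeast_prime_of_dvd_lucasD hp hQ hD
    refine ⟨?_, fun k hk => ?_, fun n hn hne => ?_⟩
    · have h := primePowerSupport_self hp hp.one_le (lucasWeight p p P Q) 0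
      rw [pow_zero, one_mul] at h
      rw [padicValRat_moebiusDual_lucasU hPQ hQ hz hp.one_le, h, lucasWeight]
    · obtain ⟨j, rfl⟩ := Nat.exists_eq_add_of_le' hk
      rw [padicValRat_moebiusDual_lucasU hPQ hQ hz (pow_pos hp.pos _), Nat.succ_eq_add_one,
        ← add_assoc, pow_succ p (j + 1), primePowerSupport_self hp hp.one_le,
        lucasWeight_succ_of_dvd_lucasD hPQ hQ hD]
    · rw [padicValRat_moebiusDual_lucasU hPQ hQ hz hn]
      exact primePowerSupport_eq_zero fun k _ hk =>
        hne (k + 1) (by omega) (by rw [hk, pow_succ])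
  · have hQ : ¬ (p : ℤ) ∣ Q := fun hQ => hQD (Dvd.dvd.mul_right hQ _)
    have hz := isLeast_entryPoint (P := P) hp hQ
    have key : ∀ k, padicValRat p (moebiusDual (lucasU P Q)
        (p ^ k * entryPoint (lucasU P Q) p)) =
          lucasWeight p (entryPoint (lucasU P Q) p) P Q k := fun k => by
      rw [padicValRat_moebiusDual_lucasU hPQ hQ hz (Nat.mul_pos (pow_pos hp.pos _) hz.1.1),
        primePowerSupport_self hp hz.1.1]
    refine ⟨hz, ?_, ?_, fun k hk => ?_, fun n hn hne => ?_⟩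
    · simpa [lucasWeight] using key 0
    · simpa [lucasWeight] using key 1
    · obtain ⟨j, rfl⟩ := Nat.exists_eq_add_of_le' hk
      exact key (j + 2)
    · rw [padicValRat_moebiusDual_lucasU hPQ hQ hz hn]
      exact primePowerSupport_eq_zero fun k _ => hne k
  · have hP' : (p : ℤ) ^ padicValInt p P * pFreePart p P = P := pow_padicValInt_mul_pFreePart p P
    have hQ' : ((p : ℤ) ^ padicValInt p P) ^ 2 * (Q / (p : ℤ) ^ (2 * padicValInt p P)) = Q := by
      rw [← pow_mul, mul_comm (padicValInt p P)]
      exact Int.mul_ediv_cancel' ((padicValInt_dvd_iff _ _).mpr (Or.inr hle))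
    have hN : LucasNondegenerate ((p : ℤ) ^ padicValInt p P * pFreePart p P)
        (((p : ℤ) ^ padicValInt p P) ^ 2 * (Q / (p : ℤ) ^ (2 * padicValInt p P))) := by
      rwa [hP', hQ']
    refine ⟨hN.of_scale, by simp [moebiusDual, lucasU], fun n hn => ?_⟩
    have h := padicValRat_moebiusDual_lucasU_scale _ hN hn.le
    rw [hP', hQ', if_neg (by omega), sub_zero] at h
    exact h
  · have hQ := (pow_padicValInt_mul_pFreePart p Q).symm
    have hQ' : ¬ (p : ℤ) ∣ pFreePart p Q := not_dvd_pFreePart hPQ.Q_ne_zero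
    set s := padicValInt p Q
    set Q' := pFreePart p Q
    obtain ⟨e, he⟩ := Nat.exists_eq_add_of_lt hlt
    -- Here e = 2 v_p(P) - s - 1, so e = 0 is exactly the condition 2 v_p(P) = v_p(Q) + 1.
    set R : ℤ := (p : ℤ) ^ e * pFreePart p P ^ 2 with hR
    have hP : P ^ 2 = (p : ℤ) ^ (s + 1) * R := by
      rw [hR, ← mul_assoc, ← pow_add, show s + 1 + e = padicValInt p P * 2 by omega, pow_mul,
        ← mul_pow, pow_padicValInt_mul_pFreePart]
    have key {n : ℕ} (hn : 1 ≤ n) := padicValRat_moebiusDual_lucasU_of_lt hPQ hQ hP hQ' hn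
    have key2 : ∀ k, padicValRat p (moebiusDual (lucasU P Q) (2 * p ^ k)) =
        (((2 * p ^ k).totient / 2 : ℕ) : ℤ) * s +
          evenWeight p P (p * R - 2 * Q') (Q' ^ 2) k := fun k => by
      rw [key (Nat.mul_pos two_pos (pow_pos hp.pos _)), mul_comm 2,
        primePowerSupport_self hp one_le_two]
    have hN := lucasNondegenerate_even_part hPQ hQ hP
    have hQ2 := not_dvd_pow_of_not_dvd hp hQ' 2
    have hD2 : (p : ℤ) ∣ lucasD (p * R - 2 * Q') (Q' ^ 2) :=
      ⟨R * (p * R - 4 * Q'), by rw [lucasD]; ring⟩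
    refine ⟨?_, fun k hk hex => ?_, fun n hn hn2 hne => ?_, fun hs hp23 => ?_⟩
    · simpa [evenWeight] using key2 0
    · rw [key2]
      congr 1
      obtain ⟨j, rfl⟩ := Nat.exists_eq_add_of_le' hk
      rw [evenWeight]
      cases j with
      | succ j => exact lucasWeight_succ_of_dvd_lucasD hN hQ2 hD2 j
      | zero =>
        rw [lucasWeight]
        -- For p = 2, 3 outside the exception, e > 0 gives p ∣ R, so R - Q' is prime to p; all other
        -- primes are at least 4.
        by_cases hp23 : p = 2 ∨ p = 3
        · rw [(padicValInt_lucasU_even_part hPQ hQ hP hQ' hp23).2,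
            padicValInt.eq_zero_of_not_dvd (p := p) (z := R - Q')]
          · simp
          · rw [dvd_sub_right]
            · exact hQ'
            · rw [hR]
              exact Dvd.dvd.mul_right (dvd_pow_self _ fun h => hex ⟨by omega, hp23, rfl⟩) _
        · have h4 : 4 ≤ p := by have := hp.two_le; omega
          rw [padicValInt_lucasU_prime_of_dvd_lucasD h4 hN.D_ne_zero hQ2 hD2]
          simp
    · rw [key hn, primePowerSupport_eq_zero, add_zero]
      intro k _ hk
      cases k with
      | zero => exact hn2 (by simpa using hk)
      | succ k => exact hne (k + 1) (by omega) (by rw [hk, mul_comm])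
    · obtain rfl : e = 0 := by omega
      obtain ⟨h0, h1⟩ := padicValInt_lucasU_even_part hPQ hQ hP hQ' hp23
      have hR1 : R = pFreePart p P ^ 2 := by rw [hR, pow_zero, one_mul]
      have h2 := key2 1
      rw [pow_one, evenWeight, lucasWeight, h1, hR1] at h2
      have hφ : (2 * p).totient / 2 = 1 := by rcases hp23 with rfl | rfl <;> decide
      rw [hR1] at h0
      refine ⟨h0, ?_⟩
      rw [h2, hφ]
      push_cast
      ring
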